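/- For a polynomial $p\in\mathbb{C}[z_1,\dots,z_d]$ let $\|p\|_\infty=\sup\{|p(z)| : z\in\mathbb{C}^d,\ |z_1|,\dots,|z_d|<1\}$, and let its Agler norm be $\|p\|_A=\sup_T\|p(T_1,\dots,T_d)\|$, where the supremum is over all $d$-tuples $T=(T_1,\dots,T_d)$ of pairwise commuting bounded operators on a common complex Hilbert space with $\|T_i\|<1$ for every $i$, and $\|\cdot\|$ is the operator norm. For positive integers $k,d$ put \[ C_k(d)=\sup\left\{\frac{\|p\|_A}{\|p\|_\infty} : p\in\mathbb{C}[z_1,\dots,z_d]\ \text{nonzero and homogeneous of degree } k\right\}. \] Then there is an absolute constant $c$ such that, for all integers $d,k\ge 2$, \[ C_k(d)\le c\,k\left(\frac{e}{2}\right)^{k} d^{\frac{k-2}{2}} . \] -/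

import Mathlib

open scoped ENNReal

universe u

noncomputable section

/-- The open unit polydisk `𝔻^d` in `ℂ^d`. -/
def polydisk (d : ℕ) : Set (Fin d → ℂ) := {z | ∀ i, ‖z i‖ < 1}

/-- The operator `p(T₁, …, T_d) = ∑_α p_α T₁^{α₁} ⋯ T_d^{α_d}`. The factors are multiplied in the
order of their indices; the order is immaterial for commuting tuples, the only ones used below. -/
def evalOp {d : ℕ} {H : Type u} [NormedAddCommGroup H] [InnerProductSpace ℂ H]
    (p : MvPolynomial (Fin d) ℂ) (T : Fin d → H →L[ℂ] H) : H →L[ℂ] H :=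
  ∑ α ∈ p.support, p.coeff α • (List.ofFn fun i => T i ^ α i).prod

/-- The supremum norm `‖p‖_∞` over the polydisk, as an extended nonnegative real. -/
def supNorm {d : ℕ} (p : MvPolynomial (Fin d) ℂ) : ℝ≥0∞ :=
  ⨆ z ∈ polydisk d, ‖MvPolynomial.eval z p‖ₑ

/-- The Agler norm `‖p‖_A`: the supremum of the operator norms `‖p(T)‖` over all `d`-tuples `T` of
commuting strict contractions on a complex Hilbert space, as an extended nonnegative real. -/
def aglerNorm {d : ℕ} (p : MvPolynomial (Fin d) ℂ) : ℝ≥0∞ :=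
  ⨆ (H : Type u) (_ : NormedAddCommGroup H) (_ : InnerProductSpace ℂ H) (_ : CompleteSpace H)
    (T : Fin d → H →L[ℂ] H) (_ : ∀ i, ‖T i‖ < 1) (_ : ∀ i j, Commute (T i) (T j)),
    ‖evalOp p T‖ₑ

/-- `C_k(d)`: the supremum of `‖p‖_A / ‖p‖_∞` over the nonzero homogeneous polynomials `p` of
degree `k` in `d` variables, for which `0 < ‖p‖_∞ < ∞`. -/
def aglerRatio (k d : ℕ) : ℝ≥0∞ :=
  ⨆ (p : MvPolynomial (Fin d) ℂ) (_ : p.IsHomogeneous k) (_ : p ≠ 0),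
    aglerNorm.{u} p / supNorm p

end

/-! The proof lowers the degree one at a time to two. Let T be a commuting tuple of contractions,
and let q have degree j and modulus at most N on the torus. Euler's identity writes j q(T)x as the
sum of T_i v_i with v_i = (∂_i q)(T)x. The parallelogram law supplies signs ε with Σ‖v_i‖² ≤ ‖Σ ε_i
v_i‖², and Σ ε_i v_i is the directional derivative D_ε q evaluated at T and applied to x.
Cauchy–Schwarz then costs a factor √d (`norm_algHom_le_of_forall_dirDeriv`).

A Bernstein inequality (`torusBound_dirDeriv`) bounds D_ε q on the torus by e(j+1)N/2. Hence degree
j costs √d (e/2)(j+1)/j, and these factors telescope.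

Stopping at degree two saves two powers of √d: there Grothendieck's inequality, proved here by
truncating Rademacher sums, gives a bound independent of d (`norm_algHom_le_of_isHomogeneous_two`).
-/

/-! ### Rademacher sums and their moments -/

/-- The value at the sign pattern `ω` of the Rademacher sum `∑ k, ± x k`. -/
def rademacherSum {n : ℕ} (x : Fin n → ℂ) (ω : Fin n → Bool) : ℂ :=
  ∑ k, (if ω k then 1 else -1) * x k

lemma rademacherSum_cons_true {n : ℕ} (x : Fin (n + 1) → ℂ) (ω : Fin n → Bool) :
    rademacherSum x (Fin.cons true ω) = rademacherSum (fun k => x k.succ) ω + x 0 := by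
  simp [rademacherSum, Fin.sum_univ_succ, add_comm]

lemma rademacherSum_cons_false {n : ℕ} (x : Fin (n + 1) → ℂ) (ω : Fin n → Bool) :
    rademacherSum x (Fin.cons false ω) = rademacherSum (fun k => x k.succ) ω - x 0 := by
  simp [rademacherSum, Fin.sum_univ_succ]
  ring

lemma sum_bool_cons {M : Type*} [AddCommMonoid M] {n : ℕ} (F : (Fin (n + 1) → Bool) → M) :
    ∑ ω, F ω = ∑ ω : Fin n → Bool, (F (Fin.cons true ω) + F (Fin.cons false ω)) := by
  rw [← (Fin.consEquiv fun _ => Bool).sum_comp, Fintype.sum_prod_type, Fintype.sum_bool,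
    Finset.sum_add_distrib]
  rfl

/-- Rademacher sums reproduce the bilinear dot product. -/
lemma sum_rademacherSum_mul {n : ℕ} (x y : Fin n → ℂ) :
    ∑ ω, rademacherSum x ω * rademacherSum y ω = 2 ^ n * ∑ k, x k * y k := by
  induction n with
  | zero => simp [rademacherSum]
  | succ n ih =>
    rw [sum_bool_cons, Fin.sum_univ_succ]
    simp only [rademacherSum_cons_true, rademacherSum_cons_false]
    have : ∀ ω, (rademacherSum (fun k => x k.succ) ω + x 0) *
          (rademacherSum (fun k => y k.succ) ω + y 0) +
        (rademacherSum (fun k => x k.succ) ω - x 0) *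
          (rademacherSum (fun k => y k.succ) ω - y 0) =
        2 * (rademacherSum (fun k => x k.succ) ω * rademacherSum (fun k => y k.succ) ω) +
          2 * (x 0 * y 0) := fun ω => by ring
    simp only [this, Finset.sum_add_distrib, ← Finset.mul_sum, ih]
    simp
    ring

lemma sum_norm_sq_rademacherSum {n : ℕ} (x : Fin n → ℂ) :
    ∑ ω, ‖rademacherSum x ω‖ ^ 2 = 2 ^ n * ∑ k, ‖x k‖ ^ 2 := by
  induction n with
  | zero => simp [rademacherSum]
  | succ n ih =>
    rw [sum_bool_cons, Fin.sum_univ_succ]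
    simp only [rademacherSum_cons_true, rademacherSum_cons_false]
    have : ∀ ω, ‖rademacherSum (fun k => x k.succ) ω + x 0‖ ^ 2 +
        ‖rademacherSum (fun k => x k.succ) ω - x 0‖ ^ 2 =
        2 * ‖rademacherSum (fun k => x k.succ) ω‖ ^ 2 + 2 * ‖x 0‖ ^ 2 := fun ω => by
      have := parallelogram_law_with_norm ℝ (rademacherSum (fun k => x k.succ) ω) (x 0)
      linarith
    simp only [this, Finset.sum_add_distrib, ← Finset.mul_sum, ih]
    simp
    ring

lemma Complex.norm_add_pow_four_add_norm_sub_pow_four_le (z w : ℂ) :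
    ‖z + w‖ ^ 4 + ‖z - w‖ ^ 4 ≤ 2 * (‖z‖ ^ 4 + 6 * ‖w‖ ^ 2 * ‖z‖ ^ 2 + ‖w‖ ^ 4) := by
  have h (u : ℂ) : ‖u‖ ^ 4 = (u.re * u.re + u.im * u.im) ^ 2 := by
    rw [← Complex.normSq_apply, Complex.normSq_eq_norm_sq]; ring
  have h2 (u : ℂ) : ‖u‖ ^ 2 = u.re * u.re + u.im * u.im := by
    rw [← Complex.normSq_apply, Complex.normSq_eq_norm_sq]
  simp only [h, h2, Complex.add_re, Complex.add_im, Complex.sub_re, Complex.sub_im]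
  nlinarith [sq_nonneg (z.re * w.im - z.im * w.re)]

lemma sum_norm_pow_four_rademacherSum_le {n : ℕ} (x : Fin n → ℂ) :
    ∑ ω, ‖rademacherSum x ω‖ ^ 4 ≤ 2 ^ n * (3 * (∑ k, ‖x k‖ ^ 2) ^ 2) := by
  induction n with
  | zero => simp [rademacherSum]
  | succ n ih =>
    rw [sum_bool_cons, Fin.sum_univ_succ]
    simp only [rademacherSum_cons_true, rademacherSum_cons_false]
    refine (Finset.sum_le_sum fun ω _ =>
      Complex.norm_add_pow_four_add_norm_sub_pow_four_le _ _).trans ?_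
    simp only [Finset.sum_add_distrib, ← Finset.mul_sum, sum_norm_sq_rademacherSum]
    simp only [Finset.sum_const, Finset.card_univ, Fintype.card_pi_const, Fintype.card_bool,
      nsmul_eq_mul, Nat.cast_pow, Nat.cast_ofNat]
    have h0 : (0 : ℝ) < 2 ^ n := by positivity
    have := mul_nonneg h0.le (sq_nonneg (‖x 0‖ ^ 2))
    rw [pow_succ]
    linear_combination 2 * ih (fun k => x k.succ) + 4 * this

/-! ### Grothendieck's inequality by truncation -/

/-- `C` bounds the action of the matrix `a` on vectors of finite-dimensional Hilbert spaces. -/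
def HilbertBound {ι : Type*} [Fintype ι] (a : ι → ι → ℂ) (C : ℝ) : Prop :=
  ∀ (n : ℕ) (x y : ι → Fin n → ℂ) (R S : ℝ), 0 < R → 0 < S →
    (∀ i, ∑ k, ‖x i k‖ ^ 2 ≤ R ^ 2) → (∀ i, ∑ k, ‖y i k‖ ^ 2 ≤ S ^ 2) →
    ‖∑ i, ∑ j, a i j * ∑ k, x i k * y j k‖ ≤ C * (R * S)

lemma HilbertBound.fintype {ι : Type*} [Fintype ι] {a : ι → ι → ℂ} {C : ℝ} (h : HilbertBound a C)
    {κ : Type*} [Fintype κ] {x y : ι → κ → ℂ} {R S : ℝ} (hR : 0 < R) (hS : 0 < S)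
    (hx : ∀ i, ∑ k, ‖x i k‖ ^ 2 ≤ R ^ 2) (hy : ∀ i, ∑ k, ‖y i k‖ ^ 2 ≤ S ^ 2) :
    ‖∑ i, ∑ j, a i j * ∑ k, x i k * y j k‖ ≤ C * (R * S) := by
  have e := (Fintype.equivFin κ).symm
  have := h _ (fun i k => x i (e k)) (fun i k => y i (e k)) R S hR hS
    (fun i => by rw [e.sum_comp (fun k => ‖x i k‖ ^ 2)]; exact hx i)
    (fun i => by rw [e.sum_comp (fun k => ‖y i k‖ ^ 2)]; exact hy i)
  convert this using 6 with i _ j _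
  rw [e.sum_comp (fun k => x i k * y j k)]

lemma norm_sum_mul_le_of_sum_norm_sq_le {κ : Type*} [Fintype κ] {x y : κ → ℂ} {R S : ℝ}
    (hR : 0 < R) (hS : 0 < S) (hx : ∑ k, ‖x k‖ ^ 2 ≤ R ^ 2) (hy : ∑ k, ‖y k‖ ^ 2 ≤ S ^ 2) :
    ‖∑ k, x k * y k‖ ≤ R * S := by
  calc ‖∑ k, x k * y k‖ ≤ ∑ k, ‖x k‖ * ‖y k‖ := by
        simpa only [norm_mul] using norm_sum_le Finset.univ fun k => x k * y k
    _ ≤ √(∑ k, ‖x k‖ ^ 2) * √(∑ k, ‖y k‖ ^ 2) := Real.sum_mul_le_sqrt_mul_sqrt _ _ _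
    _ ≤ R * S := by
        gcongr
        · exact Real.sqrt_le_iff.2 ⟨hR.le, hx⟩
        · exact Real.sqrt_le_iff.2 ⟨hS.le, hy⟩

/-- A crude finite constant, needed only to start the iteration of `HilbertBound.improve`. -/
lemma hilbertBound_sum_norm {ι : Type*} [Fintype ι] (a : ι → ι → ℂ) :
    HilbertBound a (∑ i, ∑ j, ‖a i j‖) := by
  intro n x y R S hR hS hx hy
  rw [Finset.sum_mul]
  refine norm_sum_le_of_le _ fun i _ => ?_
  rw [Finset.sum_mul]
  refine norm_sum_le_of_le _ fun j _ => ?_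
  rw [norm_mul]
  gcongr
  exact norm_sum_mul_le_of_sum_norm_sq_le hR hS (hx i) (hy j)

/-- The truncation of `z` to the disk of radius `ρ`. -/
noncomputable def diskTruncation (ρ : ℝ) (z : ℂ) : ℂ := if ‖z‖ ≤ ρ then z else 0

lemma norm_diskTruncation_le {ρ : ℝ} (hρ : 0 ≤ ρ) (z : ℂ) : ‖diskTruncation ρ z‖ ≤ ρ := by
  unfold diskTruncation; split_ifs <;> simp [*]

lemma norm_diskTruncation_le_norm (ρ : ℝ) (z : ℂ) : ‖diskTruncation ρ z‖ ≤ ‖z‖ := by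
  unfold diskTruncation; split_ifs <;> simp

lemma norm_sub_diskTruncation_sq_mul_le {ρ : ℝ} (hρ : 0 ≤ ρ) (z : ℂ) :
    ‖z - diskTruncation ρ z‖ ^ 2 * ρ ^ 2 ≤ ‖z‖ ^ 4 := by
  unfold diskTruncation; split_ifs with h
  · simp
  · rw [sub_zero, show ‖z‖ ^ 4 = ‖z‖ ^ 2 * ‖z‖ ^ 2 by ring]
    gcongr
    exact (not_le.1 h).le

/-- The fourth moment bounds the mean square of the tail by 3R⁴/(7R)² = 3R²/49 ≤ R²/16; 7 is the
least integer for which this works. -/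
lemma sum_norm_sub_diskTruncation_rademacherSum_sq_le {n : ℕ} {x : Fin n → ℂ} {R : ℝ} (hR : 0 < R)
    (hx : ∑ k, ‖x k‖ ^ 2 ≤ R ^ 2) :
    ∑ ω, ‖rademacherSum x ω - diskTruncation (7 * R) (rademacherSum x ω)‖ ^ 2 ≤
      (√(2 ^ n) * (R / 4)) ^ 2 := by
  have h1 : (∑ ω, ‖rademacherSum x ω - diskTruncation (7 * R) (rademacherSum x ω)‖ ^ 2) *
      (7 * R) ^ 2 ≤ 2 ^ n * (3 * (R ^ 2) ^ 2) := by
    rw [Finset.sum_mul]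
    refine (Finset.sum_le_sum fun ω _ =>
      norm_sub_diskTruncation_sq_mul_le (by positivity) _).trans
      ((sum_norm_pow_four_rademacherSum_le x).trans ?_)
    have : 0 ≤ ∑ k, ‖x k‖ ^ 2 := by positivity
    gcongr
  rw [mul_pow, Real.sq_sqrt (by positivity)]
  refine le_of_mul_le_mul_right (h1.trans ?_) (show 0 < (7 * R) ^ 2 by positivity)
  have : 0 ≤ (2 : ℝ) ^ n * R ^ 4 := by positivity
  nlinarith

lemma HilbertBound.improve {ι : Type*} [Fintype ι] {a : ι → ι → ℂ} {C N : ℝ}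
    (hN : ∀ s t : ι → ℂ, (∀ i, ‖s i‖ ≤ 1) → (∀ i, ‖t i‖ ≤ 1) → ‖∑ i, ∑ j, a i j * (s i * t j)‖ ≤ N)
    (h : HilbertBound a C) : HilbertBound a (49 * N + C / 2) := by
  intro n x y R S hR hS hx hy
  have hN' : ∀ (ρ σ : ℝ), 0 < ρ → 0 < σ → ∀ s t : ι → ℂ, (∀ i, ‖s i‖ ≤ ρ) → (∀ i, ‖t i‖ ≤ σ) →
      ‖∑ i, ∑ j, a i j * (s i * t j)‖ ≤ N * (ρ * σ) := by
    intro ρ σ hρ hσ s t hs ht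
    have h1 := hN (fun i => s i / ρ) (fun i => t i / σ)
      (fun i => by simpa [abs_of_pos hρ] using (div_le_one hρ).2 (hs i))
      (fun i => by simpa [abs_of_pos hσ] using (div_le_one hσ).2 (ht i))
    have h2 : ∑ i, ∑ j, a i j * (s i * t j) =
        (ρ * σ : ℂ) * ∑ i, ∑ j, a i j * (s i / ρ * (t j / σ)) := by
      simp only [Finset.mul_sum]
      have : (ρ : ℂ) ≠ 0 := by exact_mod_cast hρ.ne'
      have : (σ : ℂ) ≠ 0 := by exact_mod_cast hσ.ne'
      refine Finset.sum_congr rfl fun i _ => Finset.sum_congr rfl fun j _ => ?_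
      field_simp
    rw [h2, norm_mul, mul_comm]
    have : ‖(ρ * σ : ℂ)‖ = ρ * σ := by simp [abs_of_pos hρ, abs_of_pos hσ]
    rw [this]
    gcongr
  -- Vectors become functions on the 2ⁿ sign patterns, so the hypothesis is applied in a larger
  -- dimension; this is why `HilbertBound` quantifies over all dimensions.
  set X : ι → (Fin n → Bool) → ℂ := fun i => rademacherSum (x i)
  set Y : ι → (Fin n → Bool) → ℂ := fun i => rademacherSum (y i)
  set X' : ι → (Fin n → Bool) → ℂ := fun i ω => diskTruncation (7 * R) (X i ω)
  set Y' : ι → (Fin n → Bool) → ℂ := fun i ω => diskTruncation (7 * S) (Y i ω)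
  have hsq : √(2 ^ n) * √(2 ^ n) = (2 : ℝ) ^ n := Real.mul_self_sqrt (by positivity)
  have hY : ∀ j, ∑ ω, ‖Y j ω‖ ^ 2 ≤ (√(2 ^ n) * S) ^ 2 := fun j => by
    rw [sum_norm_sq_rademacherSum, mul_pow, sq (√_), hsq]
    gcongr
    exact hy j
  have hX' : ∀ i, ∑ ω, ‖X' i ω‖ ^ 2 ≤ (√(2 ^ n) * R) ^ 2 := fun i => by
    refine (Finset.sum_le_sum fun ω _ => pow_le_pow_left₀ (norm_nonneg _)
      (norm_diskTruncation_le_norm (7 * R) (X i ω)) 2).trans ?_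
    rw [sum_norm_sq_rademacherSum, mul_pow, sq (√_), hsq]
    gcongr
    exact hx i
  -- Split XY = (X - X')Y + X'(Y - Y') + X'Y'. Each of the first two terms has one factor of
  -- relative size 1/4 and costs C/4; the last is bounded pointwise in ω by 7 · 7 · N.
  have B1 : ‖∑ i, ∑ j, a i j * ∑ ω, (X i ω - X' i ω) * Y j ω‖ ≤
      C * (√(2 ^ n) * (R / 4) * (√(2 ^ n) * S)) :=
    h.fintype (by positivity) (by positivity)
      (fun i => sum_norm_sub_diskTruncation_rademacherSum_sq_le hR (hx i)) hY
  have B2 : ‖∑ i, ∑ j, a i j * ∑ ω, X' i ω * (Y j ω - Y' j ω)‖ ≤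
      C * (√(2 ^ n) * R * (√(2 ^ n) * (S / 4))) :=
    h.fintype (by positivity) (by positivity) hX'
      (fun i => sum_norm_sub_diskTruncation_rademacherSum_sq_le hS (hy i))
  have B3 : ‖∑ i, ∑ j, a i j * ∑ ω, X' i ω * Y' j ω‖ ≤ 2 ^ n * (N * (7 * R * (7 * S))) := by
    have e : ∑ i, ∑ j, a i j * ∑ ω, X' i ω * Y' j ω =
        ∑ ω, ∑ i, ∑ j, a i j * (X' i ω * Y' j ω) := by
      simp only [Finset.mul_sum]
      rw [Finset.sum_comm]
      conv_lhs => enter [2, j]; rw [Finset.sum_comm]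
      rw [Finset.sum_comm]
      refine Finset.sum_congr rfl fun ω _ => Finset.sum_comm
    rw [e]
    refine (norm_sum_le_of_le _ fun ω _ => hN' (7 * R) (7 * S) (by positivity) (by positivity) _ _
      (fun i => norm_diskTruncation_le (by positivity) _)
      (fun i => norm_diskTruncation_le (by positivity) _)).trans ?_
    simp
  have key : (2 : ℂ) ^ n * ∑ i, ∑ j, a i j * ∑ k, x i k * y j k =
      ∑ i, ∑ j, a i j * ∑ ω, (X i ω - X' i ω) * Y j ω +
      ∑ i, ∑ j, a i j * ∑ ω, X' i ω * (Y j ω - Y' j ω) +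
      ∑ i, ∑ j, a i j * ∑ ω, X' i ω * Y' j ω := by
    simp only [← Finset.sum_add_distrib, ← mul_add]
    simp only [Finset.mul_sum (a := (2 : ℂ) ^ n)]
    refine Finset.sum_congr rfl fun i _ => Finset.sum_congr rfl fun j _ => ?_
    rw [mul_left_comm, ← sum_rademacherSum_mul]
    congr 1
    refine Finset.sum_congr rfl fun ω _ => ?_
    simp only [X, Y]
    ring
  have hle := (norm_add₃_le (a := ∑ i, ∑ j, a i j * ∑ ω, (X i ω - X' i ω) * Y j ω)
    (b := ∑ i, ∑ j, a i j * ∑ ω, X' i ω * (Y j ω - Y' j ω))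
    (c := ∑ i, ∑ j, a i j * ∑ ω, X' i ω * Y' j ω)).trans (add_le_add (add_le_add B1 B2) B3)
  rw [← key, norm_mul, norm_pow, Complex.norm_ofNat] at hle
  refine le_of_mul_le_mul_left (hle.trans (le_of_eq ?_)) (show (0 : ℝ) < 2 ^ n by positivity)
  linear_combination (C * R * S / 2) * hsq

/-- The map C ↦ 49N + C/2 contracts to its fixed point 98N. -/
lemma hilbertBound_of_forall_norm_le {ι : Type*} [Fintype ι] {a : ι → ι → ℂ} {N : ℝ}
    (hN : ∀ s t : ι → ℂ, (∀ i, ‖s i‖ ≤ 1) → (∀ i, ‖t i‖ ≤ 1) →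
      ‖∑ i, ∑ j, a i j * (s i * t j)‖ ≤ N) : HilbertBound a (98 * N) := by
  set D := ∑ i, ∑ j, ‖a i j‖ - 98 * N
  have h : ∀ l : ℕ, HilbertBound a (98 * N + D * (1 / 2) ^ l) := by
    intro l
    induction l with
    | zero => simpa [D] using hilbertBound_sum_norm a
    | succ l ih =>
      convert ih.improve hN using 1
      rw [pow_succ]
      ring
  intro n x y R S hR hS hx hy
  have ht : Filter.Tendsto (fun l : ℕ => (98 * N + D * (1 / 2) ^ l) * (R * S)) Filter.atTop
      (nhds ((98 * N + D * 0) * (R * S))) :=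
    ((tendsto_const_nhds.add ((tendsto_pow_atTop_nhds_zero_of_lt_one (by norm_num)
      (by norm_num)).const_mul D))).mul_const _
  rw [mul_zero, add_zero] at ht
  exact ge_of_tendsto' ht fun l => h l n x y R S hR hS hx hy

/-- **Grothendieck's inequality**, with the constant `98`. -/
theorem grothendieck_inequality {ι : Type*} [Fintype ι] {a : ι → ι → ℂ} {N : ℝ}
    (hN : ∀ s t : ι → ℂ, (∀ i, ‖s i‖ ≤ 1) → (∀ i, ‖t i‖ ≤ 1) →
      ‖∑ i, ∑ j, a i j * (s i * t j)‖ ≤ N)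
    {H : Type*} [NormedAddCommGroup H] [InnerProductSpace ℂ H] (x y : ι → H)
    {R S : ℝ} (hR : 0 < R) (hS : 0 < S) (hx : ∀ i, ‖x i‖ ≤ R) (hy : ∀ i, ‖y i‖ ≤ S) :
    ‖∑ i, ∑ j, a i j * inner ℂ (x i) (y j)‖ ≤ 98 * N * (R * S) := by
  let V : Submodule ℂ H := Submodule.span ℂ (Set.range x ∪ Set.range y)
  have : FiniteDimensional ℂ V :=
    FiniteDimensional.span_of_finite ℂ ((Set.finite_range x).union (Set.finite_range y))
  let x' : ι → V := fun i => ⟨x i, Submodule.subset_span (Or.inl ⟨i, rfl⟩)⟩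
  let y' : ι → V := fun i => ⟨y i, Submodule.subset_span (Or.inr ⟨i, rfl⟩)⟩
  let b := stdOrthonormalBasis ℂ V
  -- Taking ⟨x_i, b_k⟩ and ⟨b_k, y_j⟩ as coordinates puts the conjugation into the first vector, so
  -- the bilinear bound applies.
  have := (hilbertBound_of_forall_norm_le hN).fintype
    (x := fun i k => inner ℂ (x' i) (b k)) (y := fun i k => inner ℂ (b k) (y' i)) hR hS
    (fun i => by
      rw [b.sum_sq_norm_inner_left]
      exact pow_le_pow_left₀ (norm_nonneg _) (hx i) 2)
    (fun i => by
      rw [b.sum_sq_norm_inner_right]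
      exact pow_le_pow_left₀ (norm_nonneg _) (hy i) 2)
  simp only [b.sum_inner_mul_inner] at this
  exact this

/-! ### Directional derivatives and Bernstein's inequality on the torus -/

open MvPolynomial in
lemma HasDerivAt.mvPolynomial_eval {d : ℕ} (q : MvPolynomial (Fin d) ℂ) {γ : ℂ → Fin d → ℂ}
    {γ' : Fin d → ℂ} {t : ℂ} (h : ∀ i, HasDerivAt (fun t => γ t i) (γ' i) t) :
    HasDerivAt (fun t => eval (γ t) q) (∑ i, γ' i * eval (γ t) (pderiv i q)) t := by
  induction q using MvPolynomial.induction_on with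
  | C a => simpa using hasDerivAt_const t a
  | add p q hp hq =>
    simp only [map_add, mul_add, Finset.sum_add_distrib]
    exact hp.fun_add hq
  | mul_X p i hp =>
    have e : ∑ j, γ' j * eval (γ t) (pderiv j (p * X i)) =
        (∑ j, γ' j * eval (γ t) (pderiv j p)) * γ t i + eval (γ t) p * γ' i := by
      simp only [Derivation.leibniz, pderiv_X, Pi.single_apply, smul_eq_mul, map_add, map_mul,
        eval_X, mul_add, Finset.sum_add_distrib, Finset.sum_mul]
      rw [add_comm]
      congr 1
      · exact Finset.sum_congr rfl fun j _ => by ring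
      · simp [apply_ite, mul_comm]
    rw [e]
    simp only [map_mul, eval_X]
    exact hp.fun_mul (h i)

open MvPolynomial in
lemma MvPolynomial.IsHomogeneous.eval_const_mul {d m : ℕ} {q : MvPolynomial (Fin d) ℂ}
    (hq : q.IsHomogeneous m) (c : ℂ) (x : Fin d → ℂ) :
    eval (fun i => c * x i) q = c ^ m * eval x q := by
  rw [eval_eq', eval_eq', Finset.mul_sum]
  refine Finset.sum_congr rfl fun α hα => ?_
  have : ∑ i, α i = m := by
    rw [← Finsupp.degree_eq_sum]
    by_contra h
    exact (mem_support_iff.1 hα) (hq.coeff_eq_zero h)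
  simp only [mul_pow, Finset.prod_mul_distrib, Finset.prod_pow_eq_pow_sum, this]
  ring

/-- The derivative of the polynomial `q` in the direction `y`. -/
noncomputable def dirDeriv {d : ℕ} (y : Fin d → ℂ) (q : MvPolynomial (Fin d) ℂ) :
    MvPolynomial (Fin d) ℂ :=
  ∑ i, y i • MvPolynomial.pderiv i q

lemma isHomogeneous_dirDeriv {d m : ℕ} {q : MvPolynomial (Fin d) ℂ}
    (hq : q.IsHomogeneous (m + 1)) (y : Fin d → ℂ) : (dirDeriv y q).IsHomogeneous m :=
  MvPolynomial.IsHomogeneous.sum _ _ _ fun i _ => by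
    rw [MvPolynomial.smul_eq_C_mul]
    exact (MvPolynomial.IsHomogeneous.pderiv hq).C_mul _

lemma eval_dirDeriv {d : ℕ} (x y : Fin d → ℂ) (q : MvPolynomial (Fin d) ℂ) :
    MvPolynomial.eval x (dirDeriv y q) =
      ∑ i, y i * MvPolynomial.eval x (MvPolynomial.pderiv i q) := by
  simp [dirDeriv, MvPolynomial.smul_eval]

/-- `N` bounds `|q|` on the torus. -/
def TorusBound {d : ℕ} (q : MvPolynomial (Fin d) ℂ) (N : ℝ) : Prop :=
  ∀ x : Fin d → ℂ, (∀ i, ‖x i‖ = 1) → ‖MvPolynomial.eval x q‖ ≤ N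

lemma norm_add_eq_norm_one_add_mul {w : ℂ} (hw : ‖w‖ = 1) (r : ℝ) :
    ‖(r : ℂ) + w‖ = ‖1 + (r : ℂ) * w‖ := by
  have h : w * (starRingEnd ℂ) w = 1 := by
    rw [Complex.mul_conj, Complex.normSq_eq_norm_sq, hw]
    simp
  calc ‖(r : ℂ) + w‖ = ‖w * (starRingEnd ℂ) (1 + (r : ℂ) * w)‖ := by
        congr 1
        rw [map_add, map_mul, map_one, Complex.conj_ofReal]
        linear_combination -(r : ℂ) * h
    _ = ‖1 + (r : ℂ) * w‖ := by rw [norm_mul, hw, one_mul, RCLike.norm_conj]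

/-- For r = exp(-1/(m+2)) the right side is e⁻¹(exp(2/(m+2)) - 1), and exp u ≥ 1 + u. This r is
close to the maximiser, r² = m/(m+2). -/
lemma two_div_exp_one_mul_le {m : ℕ} :
    2 / (Real.exp 1 * (m + 2)) ≤
      Real.exp (-(1 / (m + 2))) ^ m * (1 - Real.exp (-(1 / (m + 2))) ^ 2) := by
  have hm : (0 : ℝ) < m + 2 := by positivity
  rw [mul_sub, mul_one, ← pow_add, ← Real.exp_nat_mul, ← Real.exp_nat_mul]
  have e1 : (m : ℝ) * -(1 / (m + 2)) = 2 / (m + 2) + -1 := by field_simp; ring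
  have e2 : ((m + 2 : ℕ) : ℝ) * -(1 / (m + 2)) = -1 := by push_cast; field_simp
  rw [e1, e2, Real.exp_add, Real.exp_neg]
  have h := Real.add_one_le_exp (2 / ((m : ℝ) + 2))
  have he := Real.exp_pos 1
  calc 2 / (Real.exp 1 * (m + 2)) = (2 / ((m : ℝ) + 2)) * (Real.exp 1)⁻¹ := by field_simp
    _ ≤ (Real.exp (2 / ((m : ℝ) + 2)) - 1) * (Real.exp 1)⁻¹ := by gcongr; linarith
    _ = _ := by ring

/-- A Bernstein inequality on the torus: the Möbius maps `t ↦ (r x + t y) / (1 + r t x̄ y)`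
preserve the unit circle, so that Cauchy's estimate applies to the composite with `q`. -/
lemma torusBound_dirDeriv {d m : ℕ} {q : MvPolynomial (Fin d) ℂ} (hq : q.IsHomogeneous (m + 1))
    {N : ℝ} (hN : TorusBound q N) {y : Fin d → ℂ} (hy : ∀ i, ‖y i‖ = 1) :
    TorusBound (dirDeriv y q) (Real.exp 1 * (m + 2) / 2 * N) := by
  intro x hx
  set r : ℝ := Real.exp (-(1 / (m + 2))) with hr
  have hr0 : 0 < r := Real.exp_pos _
  have hr1 : r < 1 := by
    have : (0 : ℝ) < 1 / (m + 2) := by positivity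
    refine (Real.exp_lt_exp.2 (neg_lt_zero.2 this)).trans_eq Real.exp_zero
  set w : Fin d → ℂ := fun i => (starRingEnd ℂ) (x i) * y i
  have hw : ∀ i, ‖w i‖ = 1 := fun i => by simp [w, hx, hy]
  have hxw : ∀ i, x i * w i = y i := fun i => by
    simp only [w]
    rw [← mul_assoc, Complex.mul_conj, Complex.normSq_eq_norm_sq, hx]; simp
  set γ : ℂ → Fin d → ℂ := fun t i => x i * ((r + t * w i) / (1 + r * (t * w i)))
  have hden : ∀ t : ℂ, ‖t‖ ≤ 1 → ∀ i, 1 + (r : ℂ) * (t * w i) ≠ 0 := by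
    intro t ht i h0
    have h1 : ‖(r : ℂ) * (t * w i)‖ = 1 := by
      rw [show (r : ℂ) * (t * w i) = -1 by linear_combination h0]; simp
    rw [norm_mul, norm_mul, hw, mul_one, Complex.norm_real, Real.norm_of_nonneg hr0.le] at h1
    nlinarith [norm_nonneg t]
  have hderiv : ∀ t : ℂ, ‖t‖ ≤ 1 → ∀ i, HasDerivAt (fun t => γ t i)
      (x i * ((w i * (1 + r * (t * w i)) - (r + t * w i) * (r * w i)) /
        (1 + r * (t * w i)) ^ 2)) t := by
    intro t ht i
    have h1 : HasDerivAt (fun t : ℂ => t * w i) (w i) t := by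
      simpa using (hasDerivAt_id t).mul_const (w i)
    exact ((h1.const_add (r : ℂ)).div ((h1.const_mul (r : ℂ)).const_add 1) (hden t ht i)).const_mul _
  have hγ : ∀ t : ℂ, ‖t‖ = 1 → ∀ i, ‖γ t i‖ = 1 := by
    intro t ht i
    have htw : ‖t * w i‖ = 1 := by rw [norm_mul, ht, hw, one_mul]
    simp only [γ]
    rw [norm_mul, norm_div, hx, norm_add_eq_norm_one_add_mul htw, one_mul, div_self]
    exact norm_ne_zero_iff.2 (hden t ht.le i)
  have hdiff : DifferentiableOn ℂ (fun t => MvPolynomial.eval (γ t) q) (Metric.closedBall 0 1) :=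
    fun t ht => (HasDerivAt.mvPolynomial_eval q
      (hderiv t (by simpa using ht))).differentiableAt.differentiableWithinAt
  have hcauchy := Complex.norm_deriv_le_of_forall_mem_sphere_norm_le one_pos
    (hdiff.diffContOnCl_ball subset_rfl)
    (fun t ht => hN (γ t) (hγ t (by simpa using ht)))
  have hγ0 : γ 0 = fun i => (r : ℂ) * x i := by ext i; simp [γ, mul_comm]
  -- At t = 0 the curve is at r x with velocity (1 - r²) y, and the partial derivatives, homogeneous
  -- of degree m, contribute r^m.
  have h0 : deriv (fun t => MvPolynomial.eval (γ t) q) 0 =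
      ((r ^ m * (1 - r ^ 2) : ℝ) : ℂ) * MvPolynomial.eval x (dirDeriv y q) := by
    rw [(HasDerivAt.mvPolynomial_eval q (hderiv 0 (by simp))).deriv, eval_dirDeriv,
      Finset.mul_sum, hγ0]
    refine Finset.sum_congr rfl fun i _ => ?_
    rw [MvPolynomial.IsHomogeneous.eval_const_mul (MvPolynomial.IsHomogeneous.pderiv hq),
      ← hxw i, Nat.add_sub_cancel]
    push_cast
    simp
    ring
  rw [h0, norm_mul, Complex.norm_real, div_one] at hcauchy
  have hlow := two_div_exp_one_mul_le (m := m)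
  rw [← hr] at hlow
  have hpos : 0 < Real.exp 1 * (m + 2) := by positivity
  have h2 : 2 / (Real.exp 1 * (m + 2)) * ‖MvPolynomial.eval x (dirDeriv y q)‖ ≤ N :=
    (mul_le_mul_of_nonneg_right (hlow.trans (Real.le_norm_self _)) (norm_nonneg _)).trans hcauchy
  rw [div_mul_eq_mul_div, div_le_iff₀ hpos] at h2
  linarith

/-! ### Passage to the polydisk, choice of signs, polynomial calculus -/

/-- The point bisects the chord perpendicular to its radius. Averaging then carries bilinear bounds
from the torus to the polydisk. -/
lemma Complex.exists_norm_eq_one_eq_midpoint {z : ℂ} (hz : ‖z‖ ≤ 1) :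
    ∃ u v : ℂ, ‖u‖ = 1 ∧ ‖v‖ = 1 ∧ z = (u + v) / 2 := by
  refine ⟨Complex.exp ((Complex.arg z + Real.arccos ‖z‖ : ℝ) * Complex.I),
    Complex.exp ((Complex.arg z - Real.arccos ‖z‖ : ℝ) * Complex.I),
    Complex.norm_exp_ofReal_mul_I _, Complex.norm_exp_ofReal_mul_I _, ?_⟩
  have h : (‖z‖ : ℂ) = Complex.cos (Real.arccos ‖z‖) := by
    rw [← Complex.ofReal_cos, Real.cos_arccos (by linarith [norm_nonneg z]) hz]
  have h2 := Complex.two_cos (Real.arccos ‖z‖)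
  conv_lhs => rw [← Complex.norm_mul_exp_arg_mul_I z, h]
  push_cast
  rw [add_mul, sub_mul, Complex.exp_add, sub_eq_add_neg, Complex.exp_add, ← neg_mul]
  linear_combination Complex.exp (Complex.arg z * Complex.I) / 2 * h2

/-- A bound for a bilinear form on the torus extends to the closed polydisk. -/
lemma norm_sum_mul_le_of_torus {ι : Type*} [Fintype ι] {a : ι → ι → ℂ} {N : ℝ}
    (h : ∀ s t : ι → ℂ, (∀ i, ‖s i‖ = 1) → (∀ i, ‖t i‖ = 1) →
      ‖∑ i, ∑ j, a i j * (s i * t j)‖ ≤ N) (s t : ι → ℂ) (hs : ∀ i, ‖s i‖ ≤ 1)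
    (ht : ∀ i, ‖t i‖ ≤ 1) : ‖∑ i, ∑ j, a i j * (s i * t j)‖ ≤ N := by
  choose u v hu hv hs using fun i => Complex.exists_norm_eq_one_eq_midpoint (hs i)
  choose u' v' hu' hv' ht using fun i => Complex.exists_norm_eq_one_eq_midpoint (ht i)
  have e : (4 : ℂ) * ∑ i, ∑ j, a i j * (s i * t j) =
      (∑ i, ∑ j, a i j * (u i * u' j) + ∑ i, ∑ j, a i j * (u i * v' j)) +
      (∑ i, ∑ j, a i j * (v i * u' j) + ∑ i, ∑ j, a i j * (v i * v' j)) := by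
    simp only [← Finset.sum_add_distrib, Finset.mul_sum]
    refine Finset.sum_congr rfl fun i _ => Finset.sum_congr rfl fun j _ => ?_
    rw [hs, ht]
    ring
  have := congrArg norm e
  rw [norm_mul, Complex.norm_ofNat] at this
  have h1 := norm_add_le (∑ i, ∑ j, a i j * (u i * u' j) + ∑ i, ∑ j, a i j * (u i * v' j))
    (∑ i, ∑ j, a i j * (v i * u' j) + ∑ i, ∑ j, a i j * (v i * v' j))
  have h2 := norm_add_le (∑ i, ∑ j, a i j * (u i * u' j)) (∑ i, ∑ j, a i j * (u i * v' j))
  have h3 := norm_add_le (∑ i, ∑ j, a i j * (v i * u' j)) (∑ i, ∑ j, a i j * (v i * v' j))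
  linarith [h u u' hu hu', h u v' hu hv', h v u' hv hu', h v v' hv hv']

/-- By the parallelogram law, one of the two signs of each new vector does at least as well as the
average. -/
lemma exists_sign_sum_norm_sq_le {H : Type*} [NormedAddCommGroup H] [InnerProductSpace ℂ H]
    {n : ℕ} (v : Fin n → H) :
    ∃ ε : Fin n → ℂ, (∀ i, ‖ε i‖ = 1) ∧ ∑ i, ‖v i‖ ^ 2 ≤ ‖∑ i, ε i • v i‖ ^ 2 := by
  induction n with
  | zero => exact ⟨fun _ => 1, by simp, by simp⟩
  | succ n ih =>
    obtain ⟨ε, hε, h⟩ := ih fun i => v i.succ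
    have hp := parallelogram_law_with_norm ℂ (∑ i, ε i • v i.succ) (v 0)
    by_cases hc : ‖∑ i, ε i • v i.succ‖ ^ 2 + ‖v 0‖ ^ 2 ≤ ‖∑ i, ε i • v i.succ + v 0‖ ^ 2
    · refine ⟨Fin.cons 1 ε, Fin.cases (by simp) (by simpa using hε), ?_⟩
      simp only [Fin.sum_univ_succ, Fin.cons_zero, Fin.cons_succ, one_smul]
      rw [add_comm (v 0)]
      linarith
    · refine ⟨Fin.cons (-1) ε, Fin.cases (by simp) (by simpa using hε), ?_⟩
      simp only [Fin.sum_univ_succ, Fin.cons_zero, Fin.cons_succ, neg_smul, one_smul]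
      rw [neg_add_eq_sub]
      linarith

-- `aeval` requires a commutative target, so evaluation takes place in the subalgebra generated by
-- the tuple.
open scoped IsMulCommutative in
lemma exists_algHom_eq_evalOp {d : ℕ} {H : Type u} [NormedAddCommGroup H] [InnerProductSpace ℂ H]
    {T : Fin d → H →L[ℂ] H} (hT : ∀ i j, Commute (T i) (T j)) :
    ∃ φ : MvPolynomial (Fin d) ℂ →ₐ[ℂ] (H →L[ℂ] H),
      (∀ i, φ (MvPolynomial.X i) = T i) ∧ ∀ p, evalOp p T = φ p := by
  have hc : IsMulCommutative (Algebra.adjoin ℂ (Set.range T)) :=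
    Algebra.isMulCommutative_adjoin ℂ (by
      rintro _ ⟨i, rfl⟩ _ ⟨j, rfl⟩
      exact hT i j)
  let φ : MvPolynomial (Fin d) ℂ →ₐ[ℂ] (H →L[ℂ] H) :=
    (Algebra.adjoin ℂ (Set.range T)).val.comp (MvPolynomial.aeval fun i =>
      (⟨T i, Algebra.subset_adjoin ⟨i, rfl⟩⟩ : Algebra.adjoin ℂ (Set.range T)))
  have hX : ∀ i, φ (MvPolynomial.X i) = T i := fun i => by simp [φ]
  refine ⟨φ, hX, fun p => ?_⟩
  conv_rhs => rw [p.as_sum, map_sum]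
  refine Finset.sum_congr rfl fun α _ => ?_
  rw [MvPolynomial.monomial_eq, ← MvPolynomial.smul_eq_C_mul, map_smul,
    Finsupp.prod_fintype _ _ (fun _ => pow_zero _), ← List.prod_ofFn, map_list_prod, List.map_ofFn]
  congr 3
  funext i
  simp [hX]

/-! ### Operator bounds by induction on the degree -/

section

variable {d : ℕ} {H : Type*} [NormedAddCommGroup H] [InnerProductSpace ℂ H]

/-- The dimension-free bound in degree two, from Grothendieck's inequality. -/
lemma norm_algHom_le_of_isHomogeneous_two [CompleteSpace H]
    (φ : MvPolynomial (Fin d) ℂ →ₐ[ℂ] (H →L[ℂ] H)) (hφ : ∀ i, ‖φ (MvPolynomial.X i)‖ ≤ 1)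
    {q : MvPolynomial (Fin d) ℂ} (hq : q.IsHomogeneous 2) {N : ℝ} (hN : TorusBound q N) :
    ‖φ q‖ ≤ 147 / 2 * Real.exp 1 ^ 2 * N := by
  set a : Fin d → Fin d → ℂ := fun i j =>
    MvPolynomial.coeff 0 (MvPolynomial.pderiv j (MvPolynomial.pderiv i q))
  have ha : ∀ i j, MvPolynomial.pderiv j (MvPolynomial.pderiv i q) = MvPolynomial.C (a i j) := by
    intro i j
    have h : (MvPolynomial.pderiv j (MvPolynomial.pderiv i q)).IsHomogeneous 0 :=
      (hq.pderiv (i := i)).pderiv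
    rw [← MvPolynomial.totalDegree_zero_iff_isHomogeneous,
      MvPolynomial.totalDegree_eq_zero_iff_eq_C] at h
    exact h
  have hN0 : 0 ≤ N := (norm_nonneg _).trans (hN (fun _ => 1) (by simp))
  -- Two Bernstein steps, from degree 2 and then degree 1, cost 3e/2 and e.
  have hbil : ∀ s t : Fin d → ℂ, (∀ i, ‖s i‖ = 1) → (∀ i, ‖t i‖ = 1) →
      ‖∑ i, ∑ j, a i j * (s i * t j)‖ ≤ 3 / 2 * Real.exp 1 ^ 2 * N := by
    intro s t hs ht
    have h := torusBound_dirDeriv (isHomogeneous_dirDeriv (m := 1) hq s)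
      (torusBound_dirDeriv (m := 1) hq hN hs) ht
    have h1 := h (fun _ => 1) (by simp)
    have e : MvPolynomial.eval (fun _ => 1) (dirDeriv t (dirDeriv s q)) =
        ∑ i, ∑ j, a i j * (s i * t j) := by
      rw [eval_dirDeriv, Finset.sum_comm]
      refine Finset.sum_congr rfl fun j _ => ?_
      simp only [dirDeriv, map_sum, Derivation.map_smul, ha, MvPolynomial.smul_eval,
        MvPolynomial.eval_C, Finset.mul_sum]
      exact Finset.sum_congr rfl fun i _ => by ring
    rw [e] at h1
    refine h1.trans (le_of_eq ?_)
    push_cast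
    ring
  have hsum : (2 : ℂ) • q =
      ∑ i, ∑ j, a i j • (MvPolynomial.X i * MvPolynomial.X j : MvPolynomial (Fin d) ℂ) := by
    have h2 := hq.sum_X_mul_pderiv
    rw [show (2 : ℂ) • q = 2 • q by simp [two_smul], ← h2]
    refine Finset.sum_congr rfl fun i _ => ?_
    have h1 := (hq.pderiv (i := i)).sum_X_mul_pderiv
    rw [show (2 - 1 : ℕ) = 1 from rfl, one_smul] at h1
    rw [← h1, Finset.mul_sum]
    refine Finset.sum_congr rfl fun j _ => ?_
    rw [ha, MvPolynomial.smul_eq_C_mul]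
    ring
  refine ContinuousLinearMap.opNorm_le_bound _ (by positivity) fun x => ?_
  rcases eq_or_ne x 0 with rfl | hx
  · simp
  set v := φ q x
  rcases eq_or_ne v 0 with hv | hv
  · rw [hv, norm_zero]; positivity
  -- With v = q(T)x, the vectors T_i* v and T_j x turn the form into 2⟨v, v⟩.
  have hG := grothendieck_inequality (norm_sum_mul_le_of_torus hbil)
    (fun i => ContinuousLinearMap.adjoint (φ (MvPolynomial.X i)) v)
    (fun j => φ (MvPolynomial.X j) x) (norm_pos_iff.2 hv) (norm_pos_iff.2 hx)
    (fun i => ((ContinuousLinearMap.adjoint (φ (MvPolynomial.X i))).le_opNorm v).trans (by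
      rw [LinearIsometryEquiv.norm_map]
      exact mul_le_of_le_one_left (norm_nonneg _) (hφ i)))
    (fun j => ((φ (MvPolynomial.X j)).le_opNorm x).trans
      (mul_le_of_le_one_left (norm_nonneg _) (hφ j)))
  have e : ∑ i, ∑ j, a i j *
      inner ℂ (ContinuousLinearMap.adjoint (φ (MvPolynomial.X i)) v) (φ (MvPolynomial.X j) x) =
      2 * inner ℂ v v := by
    have := congrArg (fun p => inner ℂ v (φ p x)) hsum
    simp only [map_smul, map_sum, map_mul, smul_apply,
      sum_apply, inner_smul_right,
      inner_sum] at this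
    simp only [ContinuousLinearMap.adjoint_inner_left]
    exact this.symm
  rw [e, norm_mul, Complex.norm_ofNat, inner_self_eq_norm_sq_to_K, norm_pow] at hG
  simp only [Complex.coe_algebraMap, Complex.norm_real, norm_norm] at hG
  refine le_of_mul_le_mul_left ?_ (norm_pos_iff.2 hv)
  linarith

lemma norm_algHom_le_of_forall_dirDeriv {m : ℕ}
    (φ : MvPolynomial (Fin d) ℂ →ₐ[ℂ] (H →L[ℂ] H)) (hφ : ∀ i, ‖φ (MvPolynomial.X i)‖ ≤ 1)
    {q : MvPolynomial (Fin d) ℂ} (hq : q.IsHomogeneous (m + 1)) {B : ℝ}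
    (hB : ∀ y : Fin d → ℂ, (∀ i, ‖y i‖ = 1) → ‖φ (dirDeriv y q)‖ ≤ B) :
    (m + 1) * ‖φ q‖ ≤ √d * B := by
  have hB0 : 0 ≤ B := (norm_nonneg _).trans (hB (fun _ => 1) (by simp))
  have hm : (0 : ℝ) < m + 1 := by positivity
  rw [mul_comm, ← le_div_iff₀ hm]
  refine ContinuousLinearMap.opNorm_le_bound _ (by positivity) fun x => ?_
  rw [div_mul_eq_mul_div, le_div_iff₀ hm]
  set v : Fin d → H := fun i => φ (MvPolynomial.pderiv i q) x
  obtain ⟨ε, hε, hv⟩ := exists_sign_sum_norm_sq_le v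
  have h1 : ∑ i, ‖v i‖ ^ 2 ≤ (B * ‖x‖) ^ 2 := by
    refine hv.trans (pow_le_pow_left₀ (norm_nonneg _) ?_ 2)
    have : ∑ i, ε i • v i = φ (dirDeriv ε q) x := by
      simp [dirDeriv, v, map_sum]
    rw [this]
    exact ((φ (dirDeriv ε q)).le_opNorm x).trans (by gcongr; exact hB ε hε)
  have h2 : ((m : ℂ) + 1) • φ q x = ∑ i, φ (MvPolynomial.X i) (v i) := by
    have := congrArg (fun p => φ p x) hq.sum_X_mul_pderiv
    simp only [map_sum, map_mul, sum_apply,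
      map_nsmul, smul_apply] at this
    rw [← Nat.cast_smul_eq_nsmul ℂ] at this
    push_cast at this
    exact this.symm
  have h3 : ‖φ q x‖ * (m + 1) ≤ ∑ i, ‖v i‖ := by
    calc ‖φ q x‖ * (m + 1) = ‖((m : ℂ) + 1) • φ q x‖ := by
          rw [norm_smul, mul_comm]
          congr 1
          exact_mod_cast (Complex.norm_natCast (m + 1)).symm
      _ ≤ ∑ i, ‖v i‖ := by
          rw [h2]
          exact norm_sum_le_of_le _ fun i _ => ((φ (MvPolynomial.X i)).le_opNorm _).trans
            (mul_le_of_le_one_left (norm_nonneg _) (hφ i))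
  calc ‖φ q x‖ * (m + 1) ≤ ∑ i, 1 * ‖v i‖ := by simpa using h3
    _ ≤ √(∑ i : Fin d, 1 ^ 2) * √(∑ i, ‖v i‖ ^ 2) := Real.sum_mul_le_sqrt_mul_sqrt _ _ _
    _ ≤ √d * (B * ‖x‖) := by
        gcongr
        · simp
        · exact Real.sqrt_le_iff.2 ⟨by positivity, h1⟩
    _ = √d * B * ‖x‖ := by ring

/-- The step from degree m + 2 to m + 3 multiplies by √d (e/2)(m+4)/(m+3), so the product telescopes
to the factor m + 3 in the bound. -/
lemma norm_algHom_le_of_torusBound [CompleteSpace H]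
    (φ : MvPolynomial (Fin d) ℂ →ₐ[ℂ] (H →L[ℂ] H)) (hφ : ∀ i, ‖φ (MvPolynomial.X i)‖ ≤ 1)
    (m : ℕ) {q : MvPolynomial (Fin d) ℂ} (hq : q.IsHomogeneous (m + 2)) {N : ℝ}
    (hN : TorusBound q N) :
    ‖φ q‖ ≤ 49 / 2 * Real.exp 1 ^ 2 * (m + 3) * (√d * (Real.exp 1 / 2)) ^ m * N := by
  induction m generalizing q N with
  | zero =>
    refine (norm_algHom_le_of_isHomogeneous_two φ hφ hq hN).trans (le_of_eq ?_)
    push_cast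
    ring
  | succ m ih =>
    have h := norm_algHom_le_of_forall_dirDeriv φ hφ (m := m + 2) hq fun y hy =>
      ih (isHomogeneous_dirDeriv (m := m + 2) hq y) (torusBound_dirDeriv (m := m + 2) hq hN hy)
    push_cast at h ⊢
    have hm : (0 : ℝ) < m + 2 + 1 := by positivity
    refine le_of_mul_le_mul_left (h.trans (le_of_eq ?_)) hm
    ring

end

/-! ### From the supremum norm to the final constant -/

-- Torus points are limits of the points r x of the open polydisk as r → 1.
open Filter Topology in
lemma torusBound_toReal_supNorm {d k : ℕ} {p : MvPolynomial (Fin d) ℂ} (hp : p.IsHomogeneous k)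
    (h : supNorm p ≠ ∞) : TorusBound p (supNorm p).toReal := by
  intro x hx
  have hr : ∀ᶠ r : ℝ in 𝓝[<] 1, r ^ k * ‖MvPolynomial.eval x p‖ ≤ (supNorm p).toReal := by
    filter_upwards [Ioo_mem_nhdsLT (show (0 : ℝ) < 1 by norm_num)] with r hr
    have hmem : (fun i => (r : ℂ) * x i) ∈ polydisk d := fun i => by
      simpa [hx, abs_of_pos hr.1] using hr.2
    have h1 : ‖MvPolynomial.eval (fun i => (r : ℂ) * x i) p‖ₑ ≤ supNorm p :=
      le_iSup₂ (f := fun z (_ : z ∈ polydisk d) => ‖MvPolynomial.eval z p‖ₑ) _ hmem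
    have h2 := ENNReal.toReal_mono h h1
    rw [toReal_enorm, hp.eval_const_mul, norm_mul, norm_pow, Complex.norm_real,
      Real.norm_of_nonneg hr.1.le] at h2
    exact h2
  have ht : Tendsto (fun r : ℝ => r ^ k * ‖MvPolynomial.eval x p‖) (𝓝[<] 1)
      (𝓝 (1 ^ k * ‖MvPolynomial.eval x p‖)) :=
    ((by fun_prop : Continuous fun r : ℝ => r ^ k * ‖MvPolynomial.eval x p‖).tendsto 1).mono_left
      nhdsWithin_le_nhds
  simpa using le_of_tendsto ht hr

/-- Equality holds at m = 0, which fixes the constant 147. -/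
lemma aglerConstant_le {d m : ℕ} :
    49 / 2 * Real.exp 1 ^ 2 * (m + 3) * (√d * (Real.exp 1 / 2)) ^ m ≤
      147 * ((m + 2 : ℕ) : ℝ) * (Real.exp 1 / 2) ^ (m + 2) *
        (d : ℝ) ^ ((((m + 2 : ℕ) : ℝ) - 2) / 2) := by
  have e : (d : ℝ) ^ ((((m + 2 : ℕ) : ℝ) - 2) / 2) = √d ^ m := by
    rw [Real.sqrt_eq_rpow, ← Real.rpow_natCast, ← Real.rpow_mul (by positivity)]
    congr 1
    push_cast
    ring
  rw [e, mul_pow, pow_add]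
  have h : 0 ≤ Real.exp 1 ^ 2 * (Real.exp 1 / 2) ^ m * √d ^ m := by positivity
  have hm : (0 : ℝ) ≤ m := by positivity
  push_cast
  nlinarith [mul_nonneg h hm]

theorem theorem5 :
    ∃ c : ℝ, ∀ d k : ℕ, 2 ≤ d → 2 ≤ k →
      aglerRatio.{u} k d ≤
        ENNReal.ofReal (c * k * (Real.exp 1 / 2) ^ k * (d : ℝ) ^ (((k : ℝ) - 2) / 2)) := by
  refine ⟨147, fun d k hd hk => ?_⟩
  obtain ⟨m, rfl⟩ := Nat.exists_eq_add_of_le' hk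
  refine iSup_le fun p => iSup_le fun hp => iSup_le fun _ => ENNReal.div_le_of_le_mul ?_
  have hd0 : (0 : ℝ) < d := by exact_mod_cast (by omega : 0 < d)
  have hpos : 0 < 147 * ((m + 2 : ℕ) : ℝ) * (Real.exp 1 / 2) ^ (m + 2) *
      (d : ℝ) ^ ((((m + 2 : ℕ) : ℝ) - 2) / 2) := by positivity
  -- An infinite supremum norm makes the bound trivial, so its finiteness need not be proved.
  by_cases htop : supNorm p = ∞
  · rw [htop, ENNReal.mul_top (by simpa using hpos)]
    exact le_top
  refine iSup_le fun H => iSup_le fun _ => iSup_le fun _ => iSup_le fun _ => iSup_le fun T =>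
    iSup_le fun hT => iSup_le fun hcomm => ?_
  obtain ⟨φ, hφ, hev⟩ := exists_algHom_eq_evalOp hcomm
  have h := norm_algHom_le_of_torusBound φ (fun i => by rw [hφ]; exact (hT i).le) m hp
    (torusBound_toReal_supNorm hp htop)
  rw [hev, ← ofReal_norm, ← ENNReal.ofReal_toReal htop, ← ENNReal.ofReal_mul hpos.le]
  refine ENNReal.ofReal_le_ofReal (h.trans ?_)
  exact mul_le_mul_of_nonneg_right aglerConstant_le ENNReal.toReal_nonneg
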